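/- Let $\Omega\subset\mathbb R^N$ be convex and compact. Write $\|g\|_{\Omega}=\sup_{\Omega}|g|$ for continuous $g$. Let $\mathbf X_0(\Omega)$ be the set of distributions $f\in\mathcal D'(\mathbb R^N)$ such that, for some constant $C$, $$\langle f,\varphi\rangle\le C\big(\|\varphi\|_{\Omega}+\|\nabla\varphi\|_{\Omega}\big)\qquad\text{for all }\varphi\in\mathcal D(\mathbb R^N),$$ and such that $\langle f,\varphi\rangle=0$ whenever $\varphi\in\mathcal D(\mathbb R^N)$ is constant on $\Omega$. Let $\mathbf X_0^\sharp(\Omega)$ be the set of those $f\in\mathbf X_0(\Omega)$ such that for every $\varepsilon>0$ there is $C_\varepsilon>0$ with $$|\langle f,\varphi\rangle|\le C_\varepsilon\|\varphi\|_{\Omega}+\varepsilon\|\nabla\varphi\|_{\Omega}\qquad\text{for all }\varphi\in\mathcal D(\mathbb R^N).$$ Let $C^1_0(\mathbb R^N)$ be the space of $C^1$ functions that vanish at infinity together with their gradients. An element $f\in\mathbf X_0(\Omega)$ acts on $C^1_0(\mathbb R^N)$ by continuous extension with respect to uniform convergence on $\Omega$ of functions and their gradients. For $f\in\mathbf X_0(\Omega)$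 set $$\mathcal W^1(f)=\sup\{\langle f,u\rangle:\ u\in C^1_0(\mathbb R^N),\ |\nabla u|\le 1\text{ on }\mathbb R^N\},\qquad \mathcal W^1(f,\mathbf X_0^\sharp(\Omega))=\inf_{g\in\mathbf X_0^\sharp(\Omega)}\mathcal W^1(f-g).$$ For $\varphi\in C^1_0(\mathbb R^N)$, $x\in\Omega$, $v\in S^{N-1}$, $t\ge 0$, put $D_\varphi(x,v,t)=\frac{\varphi(x+tv)-\varphi(x)}{t}$ if $t\ne0$ and $D_\varphi(x,v,0)=\nabla\varphi(x)\cdot v$. For a finite nonnegative Borel measure $\sigma$ on $\Omega\times S^{N-1}\times[0,\infty)$, write $\pi_\sharp\sigma=f$ if $$\int D_\varphi\,d\sigma=\langle f,\varphi\rangle\qquad\text{for all }\varphi\in C^1_0(\mathbb R^N),$$ and let $\sigma_0$ be the restriction of $\sigma$ to $\Omega\times S^{N-1}\times\{0\}$, with total mass $\|\sigma_0\|$. Then for every $f\in\mathbf X_0(\Omega)$, $$\mathcal W^1(f,\mathbf X_0^\sharp(\Omega))=\inf\big\{\|\sigma_0\|:\ \sigma\text{ a finite nonnegative Borel measure on }\Omega\times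 S^{N-1}\times[0,\infty),\ \pi_\sharp\sigma=f\big\}.$$ -/

import Mathlib

open scoped Distributions

namespace Transhipment

/-- `ℝ^N` with its Euclidean norm. -/
abbrev Space (N : ℕ) : Type := EuclideanSpace ℝ (Fin N)

/-- Test functions `𝓓(ℝ^N)`. -/
abbrev Test (N : ℕ) : Type := 𝓓((⊤ : TopologicalSpace.Opens (Space N)), ℝ)

/-- Distributions `𝓓'(ℝ^N)`. -/
abbrev Distr (N : ℕ) : Type := 𝓓'((⊤ : TopologicalSpace.Opens (Space N)), ℝ)

/-- `‖g‖_{L^∞(Ω)}`, used below only for functions that are continuous on the compact set `Ω`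
(and equal to `0` if `Ω` is empty). -/
noncomputable def supNormOn {N : ℕ} {F : Type*} [NormedAddCommGroup F]
    (Ω : Set (Space N)) (g : Space N → F) : ℝ :=
  ⨆ x : Ω, ‖g x‖

/-- The space `X₀(Ω)` of distributions of order one on `Ω` with zero average. -/
def X0 {N : ℕ} (Ω : Set (Space N)) : Set (Distr N) :=
  {f | (∃ C : ℝ, ∀ φ : Test N,
          f φ ≤ C * (supNormOn Ω φ + supNormOn Ω (fderiv ℝ φ))) ∧
       ∀ φ : Test N, (∃ c : ℝ, ∀ x ∈ Ω, φ x = c) → f φ = 0}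

/-- The subspace `X₀^♯(Ω)`. -/
def X0sharp {N : ℕ} (Ω : Set (Space N)) : Set (Distr N) :=
  {f | f ∈ X0 Ω ∧ ∀ ε : ℝ, 0 < ε → ∃ Cε : ℝ, 0 < Cε ∧ ∀ φ : Test N,
          |f φ| ≤ Cε * supNormOn Ω φ + ε * supNormOn Ω (fderiv ℝ φ)}

/-- The space `C¹₀(ℝ^N)`: `u` is of class `C¹` and `u`, `Du` vanish at infinity. -/
def IsC10 {N : ℕ} (u : Space N → ℝ) : Prop :=
  ContDiff ℝ 1 u ∧
    Filter.Tendsto u (Filter.cocompact (Space N)) (nhds 0) ∧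
    Filter.Tendsto (fderiv ℝ u) (Filter.cocompact (Space N)) (nhds 0)

/-- The filter on test functions `φ` that expresses `φ → u` in `C¹(Ω)`,
that is, `φ → u` and `Dφ → Du` uniformly on `Ω`. -/
def c1Approach {N : ℕ} (Ω : Set (Space N)) (u : Space N → ℝ) : Filter (Test N) :=
  ⨅ ε ∈ Set.Ioi (0 : ℝ), Filter.principal
    {φ : Test N | ∀ x ∈ Ω, |φ x - u x| ≤ ε ∧ ‖fderiv ℝ φ x - fderiv ℝ u x‖ ≤ ε}

/-- The duality `⟨f, u⟩` between `f ∈ X₀(Ω)` and a function `u` of class `C¹`: the value at `u` of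
the extension of `f` by continuity for the norm of `C¹(Ω)`, that is, the limit of `⟨f, φ⟩` as the
test function `φ` tends to `u` in `C¹(Ω)`. -/
noncomputable def pairing {N : ℕ} (Ω : Set (Space N)) (f : Distr N) (u : Space N → ℝ) : ℝ :=
  Filter.limUnder (c1Approach Ω u) (fun φ : Test N => f φ)

/-- The Wasserstein norm `W¹(f) = sup {⟨f, u⟩ : u ∈ C¹₀(ℝ^N), ‖∇u‖_∞ ≤ 1}`. -/
noncomputable def W1 {N : ℕ} (Ω : Set (Space N)) (f : Distr N) : EReal :=
  ⨆ u ∈ {u : Space N → ℝ | IsC10 u ∧ ∀ x, ‖fderiv ℝ u x‖ ≤ 1}, ((pairing Ω f u : ℝ) : EReal)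

/-- The distance `W¹(f, X₀^♯(Ω))`. -/
noncomputable def distX0sharp {N : ℕ} (Ω : Set (Space N)) (f : Distr N) : EReal :=
  ⨅ g ∈ X0sharp Ω, W1 Ω (f - g)

/-- The space `Ω × S^{N-1} × [0, ∞)`. -/
abbrev Phase {N : ℕ} (Ω : Set (Space N)) : Type :=
  Ω × Metric.sphere (0 : Space N) 1 × Set.Ici (0 : ℝ)

/-- `D_φ(x, v, t)`: the difference quotient of `φ` at `x` in direction `v` with step `t`, and the
directional derivative if `t = 0`. -/
noncomputable def diffQuot {N : ℕ} (φ : Space N → ℝ) (x v : Space N) (t : ℝ) : ℝ :=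
  if t = 0 then fderiv ℝ φ x v else (φ (x + t • v) - φ x) / t

/-- The finite positive measures `σ` on `Ω × S^{N-1} × [0, ∞)` with `π_♯ σ = f`, that is,
`∫ D_φ dσ = ⟨f, φ⟩` for all `φ ∈ C¹₀(ℝ^N)`. -/
def admissible {N : ℕ} (Ω : Set (Space N)) (f : Distr N) :
    Set (MeasureTheory.Measure (Phase Ω)) :=
  {σ | MeasureTheory.IsFiniteMeasure σ ∧ ∀ φ : Space N → ℝ, IsC10 φ →
    ∫ p, diffQuot φ (p.1 : Space N) (p.2.1 : Space N) (p.2.2 : ℝ) ∂σ = pairing Ω f φ}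

/-- `σ₀`, the restriction of `σ` to `Ω × S^{N-1} × {0}`. -/
noncomputable def slice0 {N : ℕ} {Ω : Set (Space N)} (σ : MeasureTheory.Measure (Phase Ω)) :
    MeasureTheory.Measure (Phase Ω) :=
  σ.restrict {p | (p.2.2 : ℝ) = 0}

end Transhipment

/-! Upper bound. Let `σ` be admissible and `G φ = ∫ ∇φ(x)·v dσ₀`. Then `(f - G) φ` is the integral
of `D_φ` over the positive steps. Steps of length at least `d` contribute at most `2 ‖φ‖ / d` times
the mass of `σ`; shorter ones contribute at most `‖∇φ‖ σ(0 < t < d)`, and this mass tends to 0 with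
`d`. So `f - G` lies in `X₀^♯`, and its distance to `f` is `W¹(G) ≤ ‖σ₀‖` (`distX0sharp_le`).

Lower bound. Let `g ∈ X₀^♯` and `W¹(f - g) < m`. Then `(f - g) φ ≤ m sup_Ω |∇φ|`. As `g` ignores
constants, `g φ` is bounded by `C_ε` times the oscillation of `φ` plus `ε sup_Ω |∇φ|`; differences
over pairs closer than `τ = ε / C_ε` are absorbed in the gradient, the others are slopes between
distant points. Hence `f φ` is at most `m + 2ε` times a supremum of directional derivatives plus a
multiple of a supremum of distant slopes. Hahn-Banach and Riesz turn this into positive measures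
(`exists_measures_of_le`). Only the first charges `t = 0`, and its mass is at most `m + 2ε`.

Both halves must pass between bounds on `Ω` and on the whole space, since `x + t v` may leave `Ω`
and `W¹` constrains gradients everywhere. `exists_contDiff_approx` does this, using convexity. -/

namespace Transhipment

open MeasureTheory Metric Set Filter Topology Convolution ContinuousLinearMap

/-! ### Mollification of continuous functions. -/

section Mollification

variable {E : Type*} [NormedAddCommGroup E] [InnerProductSpace ℝ E] [FiniteDimensional ℝ E]
  [MeasurableSpace E] [BorelSpace E] {μ : Measure E} [μ.IsAddHaarMeasure]

theorem contDiff_mollify (ρ : ContDiffBump (0 : E)) {w : E → ℝ} (hw : Continuous w) (n : ℕ∞) :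
    ContDiff ℝ n (ρ.normed μ ⋆[lsmul ℝ ℝ, μ] w) :=
  ρ.hasCompactSupport_normed.contDiff_convolution_left _ ρ.contDiff_normed hw.locallyIntegrable

theorem integrable_normed_mul (ρ : ContDiffBump (0 : E)) {w : E → ℝ} (hw : Continuous w) (x : E) :
    Integrable (fun t ↦ ρ.normed μ t * w (x - t)) μ :=
  (ρ.continuous_normed.mul (hw.comp (continuous_const.sub continuous_id))).integrable_of_hasCompactSupport
    ρ.hasCompactSupport_normed.mul_right

theorem mollify_apply (ρ : ContDiffBump (0 : E)) (w : E → ℝ) (x : E) :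
    (ρ.normed μ ⋆[lsmul ℝ ℝ, μ] w) x = ∫ t, ρ.normed μ t * w (x - t) ∂μ := by
  simp [convolution_def]

/-- If a continuous function is bounded by `C` on the support of the averaging kernel, so is its
average. -/
theorem abs_integral_normed_mul_le (ρ : ContDiffBump (0 : E)) {g : E → ℝ}
    {C : ℝ} (hC : ∀ t, ‖t‖ < ρ.rOut → |g t| ≤ C) :
    |∫ t, ρ.normed μ t * g t ∂μ| ≤ C := by
  have h1 : ∀ t, ‖ρ.normed μ t * g t‖ ≤ ρ.normed μ t * C := by
    intro t
    rw [norm_mul, Real.norm_of_nonneg (ρ.nonneg_normed t)]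
    by_cases ht : ‖t‖ < ρ.rOut
    · exact mul_le_mul_of_nonneg_left (hC t ht) (ρ.nonneg_normed t)
    · have : ρ.normed μ t = 0 := by
        have : t ∉ Function.support (ρ.normed μ) := by
          rw [ρ.support_normed_eq]; simpa using ht
        simpa using this
      simp [this]
  have h2 := norm_integral_le_of_norm_le (ρ.integrable_normed.mul_const C)
    (Eventually.of_forall h1)
  rwa [integral_mul_const, ρ.integral_normed, one_mul] at h2

theorem abs_mollify_le (ρ : ContDiffBump (0 : E)) {w : E → ℝ} {C : ℝ} (hC : ∀ x, |w x| ≤ C) (x : E) :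
    |(ρ.normed μ ⋆[lsmul ℝ ℝ, μ] w) x| ≤ C := by
  rw [mollify_apply]
  exact abs_integral_normed_mul_le ρ fun t _ ↦ hC _

/-- If `w - A` is `c`-Lipschitz near `x`, then the derivative at `x` of a mollification of `w` is
`c`-close to `A`. -/
theorem norm_fderiv_mollify_sub_le (ρ : ContDiffBump (0 : E)) {w : E → ℝ} (hw : Continuous w)
    (A : E →L[ℝ] ℝ) {c : ℝ} (hc : 0 ≤ c) (x : E)
    (h : ∀ y ∈ ball x (2 * ρ.rOut), ∀ z ∈ ball x (2 * ρ.rOut), |w y - w z - A (y - z)| ≤ c * ‖y - z‖) :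
    ‖fderiv ℝ (ρ.normed μ ⋆[lsmul ℝ ℝ, μ] w) x - A‖ ≤ c := by
  set W := ρ.normed μ ⋆[lsmul ℝ ℝ, μ] w with hW
  have hd : HasFDerivAt (fun y ↦ W y - A y) (fderiv ℝ W x - A) x :=
    (((contDiff_mollify ρ hw 1).differentiable (by simp)) x).hasFDerivAt.sub A.hasFDerivAt
  refine hd.le_of_lip' hc ?_
  filter_upwards [ball_mem_nhds x ρ.rOut_pos] with y hy
  -- The kernel has integral one, so `A (y - x)` goes under the average. Both `x - t` and `y - t`
  -- stay within `2 * rOut` of `x`.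
  have key : W y - A y - (W x - A x) =
      ∫ t, ρ.normed μ t * (w (y - t) - w (x - t) - A (y - x)) ∂μ := by
    have h1 := integrable_normed_mul (μ := μ) ρ hw y
    have h2 := integrable_normed_mul (μ := μ) ρ hw x
    have h3 : Integrable (fun t ↦ ρ.normed μ t * A (y - x)) μ := ρ.integrable_normed.mul_const _
    simp_rw [mul_sub]
    rw [integral_sub (f := fun t ↦ ρ.normed μ t * w (y - t) - ρ.normed μ t * w (x - t))
        (h1.sub h2) h3, integral_sub h1 h2, integral_mul_const, ρ.integral_normed,
      hW, mollify_apply, mollify_apply, map_sub]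
    ring
  rw [key, Real.norm_eq_abs]
  refine abs_integral_normed_mul_le ρ fun t ht ↦ ?_
  have hy' : ‖y - x‖ < ρ.rOut := by simpa [dist_eq_norm] using hy
  have := h (y - t) ?_ (x - t) ?_
  · simpa using this
  · rw [mem_ball, dist_eq_norm]
    calc ‖y - t - x‖ = ‖(y - x) - t‖ := by congr 1; abel
      _ ≤ ‖y - x‖ + ‖t‖ := norm_sub_le _ _
      _ < _ := by linarith
  · rw [mem_ball, dist_eq_norm]
    have : ‖x - t - x‖ = ‖t‖ := by rw [sub_sub_cancel_left, norm_neg]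
    linarith [ρ.rOut_pos]

end Mollification

/-! ### Approximation in C¹(Ω) with global bounds. -/

section Approximation

variable {E : Type*} [NormedAddCommGroup E] [InnerProductSpace ℝ E] [FiniteDimensional ℝ E]

/-- Smooth cutoff functions with small gradient. -/
theorem exists_cutoff_fderiv_le (R : ℝ) {η : ℝ} (hη : 0 < η) :
    ∃ χ : E → ℝ, ContDiff ℝ (⊤ : ℕ∞) χ ∧ HasCompactSupport χ ∧ (∀ x, |χ x| ≤ 1) ∧
      (∀ x ∈ ball 0 R, χ x = 1) ∧ ∀ x, ‖fderiv ℝ χ x‖ ≤ η := by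
  let b : ContDiffBump (0 : E) := ⟨1, 2, one_pos, one_lt_two⟩
  have hb : ContDiff ℝ (⊤ : ℕ∞) b := b.contDiff
  obtain ⟨B, hB⟩ := (hb.continuous_fderiv (by simp)).bounded_above_of_compact_support
    (b.hasCompactSupport.fderiv ℝ)
  have hB0 : 0 ≤ B := (norm_nonneg _).trans (hB 0)
  -- Dilation by `s` divides the gradient bound `B` by `s`; `R ≤ s` keeps the value 1 on the ball.
  set s : ℝ := max 1 (max R (B / η)) with hs
  have hs0 : 0 < s := one_pos.trans_le (le_max_left _ _)
  have hsR : R ≤ s := (le_max_left _ _).trans (le_max_right _ _)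
  have hsB : B / η ≤ s := (le_max_right _ _).trans (le_max_right _ _)
  refine ⟨fun x ↦ b (s⁻¹ • x), hb.comp (contDiff_const_smul _), ?_, ?_, ?_, ?_⟩
  · exact b.hasCompactSupport.comp_homeomorph (Homeomorph.smulOfNeZero s⁻¹ (inv_ne_zero hs0.ne'))
  · intro x
    rw [abs_of_nonneg b.nonneg]
    exact b.le_one
  · intro x hx
    refine b.one_of_mem_closedBall ?_
    rw [mem_closedBall_zero_iff, norm_smul, Real.norm_of_nonneg (inv_nonneg.2 hs0.le)]
    rw [mem_ball_zero_iff] at hx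
    change s⁻¹ * ‖x‖ ≤ 1
    rw [inv_mul_le_iff₀ hs0]
    linarith
  · intro x
    rw [fderiv_comp_smul, norm_smul, Real.norm_of_nonneg (inv_nonneg.2 hs0.le),
      inv_mul_le_iff₀ hs0]
    calc _ ≤ B := hB _
      _ ≤ s * η := by rwa [div_le_iff₀ hη] at hsB

/-- A `C¹` function on a neighborhood of a compact convex set can be approximated in `C¹` of this
set by test functions whose sup norm and Lipschitz constant on the whole space are controlled by
the values on the set. -/
theorem exists_contDiff_approx {Ω : Set E} (hΩ : Convex ℝ Ω) (hc : IsCompact Ω) {φ : E → ℝ}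
    (hφ : ContDiff ℝ 1 φ) {L M : ℝ} (hL0 : 0 ≤ L) (hM0 : 0 ≤ M) (hM : ∀ x ∈ Ω, |φ x| ≤ M)
    (hL : ∀ x ∈ Ω, ‖fderiv ℝ φ x‖ ≤ L) {ε : ℝ} (hε : 0 < ε) :
    ∃ u : E → ℝ, ContDiff ℝ (⊤ : ℕ∞) u ∧ HasCompactSupport u ∧ (∀ x, |u x| ≤ M + ε) ∧
      (∀ x, ‖fderiv ℝ u x‖ ≤ L + ε) ∧
      ∀ x ∈ Ω, |u x - φ x| ≤ ε ∧ ‖fderiv ℝ u x - fderiv ℝ φ x‖ ≤ ε := by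
  let _ : MeasurableSpace E := borel E
  have : BorelSpace E := ⟨rfl⟩
  -- Compactness gives one `δ` for all `x ∈ Ω`, with `y` allowed outside `Ω`.
  obtain ⟨δ, hδ, hφδ⟩ : ∃ δ > 0, ∀ x ∈ Ω, ∀ y ∈ ball x δ,
      |φ y - φ x| ≤ ε / 2 ∧ ‖fderiv ℝ φ y - fderiv ℝ φ x‖ ≤ ε / 2 := by
    have h1 := hc.uniformContinuousAt_of_continuousAt (fun x ↦ (φ x, fderiv ℝ φ x))
      (fun x _ ↦ (hφ.continuous.prodMk (hφ.continuous_fderiv (by simp))).continuousAt)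
      (dist_mem_uniformity (half_pos hε))
    obtain ⟨δ, hδ, h⟩ := Metric.mem_uniformity_dist.1 h1
    refine ⟨δ, hδ, fun x hx y hy ↦ ?_⟩
    have h2 := h (a := x) (b := y) (by rwa [dist_comm]) hx
    simp only [mem_ofPred_eq, Prod.dist_eq, max_lt_iff] at h2
    rw [dist_comm, dist_eq_norm, dist_comm, dist_eq_norm] at h2
    exact ⟨h2.1.le, h2.2.le⟩
  have hdiff : Differentiable ℝ φ := hφ.differentiable (by simp)
  have hLε : 0 ≤ L + ε / 2 := by positivity
  have hMε : 0 ≤ M + ε / 2 := by positivity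
  -- The thickening is convex, so the gradient bound makes `φ` Lipschitz there with the same
  -- constant, which the extension to `E` preserves.
  obtain ⟨w₀, hw₀, hw₀φ⟩ : ∃ w₀ : E → ℝ, LipschitzWith (L + ε / 2).toNNReal w₀ ∧
      EqOn φ w₀ (thickening δ Ω) := by
    refine LipschitzOnWith.extend_real ((hΩ.thickening δ).lipschitzOnWith_of_nnnorm_fderiv_le
      (𝕜 := ℝ) (fun x _ ↦ hdiff x) fun y hy ↦ ?_)
    obtain ⟨x, hx, hxy⟩ := mem_thickening_iff.1 hy
    rw [← NNReal.coe_le_coe, coe_nnnorm, Real.coe_toNNReal _ hLε]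
    have := norm_sub_norm_le (fderiv ℝ φ y) (fderiv ℝ φ x)
    linarith [(hφδ x hx y hxy).2, hL x hx]
  -- Truncation bounds the extension, does not increase its Lipschitz constant, and changes nothing
  -- within `δ` of `Ω`.
  set w : E → ℝ := fun x ↦ max (min (w₀ x) (M + ε / 2)) (-(M + ε / 2)) with hw
  have hwL : LipschitzWith (L + ε / 2).toNNReal w := (hw₀.min_const _).max_const _
  have hwc := hwL.continuous
  have hwM : ∀ x, |w x| ≤ M + ε / 2 := fun x ↦
    abs_le.2 ⟨le_max_right _ _, max_le (min_le_right _ _) (by linarith)⟩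
  have hwφ : ∀ x ∈ Ω, ∀ y ∈ ball x δ, w y = φ y := by
    intro x hx y hy
    have h1 : w₀ y = φ y := (hw₀φ (mem_thickening_iff.2 ⟨x, hx, hy⟩)).symm
    have h2 := abs_le.1 (hφδ x hx y hy).1
    have h3 := abs_le.1 (hM x hx)
    rw [hw]
    simp only
    rw [h1, min_eq_left (by linarith), max_eq_left (by linarith)]
  let ρ : ContDiffBump (0 : E) := ⟨δ / 4, δ / 2, by positivity, by linarith⟩
  have hρ : 2 * ρ.rOut = δ := by change 2 * (δ / 2) = δ; ring
  have hρ' : ρ.rOut ≤ δ := by linarith [ρ.rOut_pos]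
  set W := ρ.normed volume ⋆[lsmul ℝ ℝ, volume] w with hW
  have hWs : ContDiff ℝ (⊤ : ℕ∞) W := contDiff_mollify ρ hwc _
  have hWd : Differentiable ℝ W := hWs.differentiable (by simp)
  have hWM : ∀ x, |W x| ≤ M + ε / 2 := abs_mollify_le ρ hwM
  have hWL : ∀ x, ‖fderiv ℝ W x‖ ≤ L + ε / 2 := by
    intro x
    have := norm_fderiv_mollify_sub_le (μ := volume) ρ hwc 0 hLε x fun y _ z _ ↦ by
      simpa [Real.coe_toNNReal _ hLε] using hwL.norm_sub_le y z
    simpa using this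
  have hWφ : ∀ x ∈ Ω, |W x - φ x| ≤ ε ∧ ‖fderiv ℝ W x - fderiv ℝ φ x‖ ≤ ε := by
    intro x hx
    constructor
    · have h1 := ρ.dist_normed_convolution_le (μ := volume) (x₀ := x) (ε := ε / 2)
        hwc.aestronglyMeasurable fun y hy ↦ by
          rw [hwφ x hx y (ball_subset_ball hρ' hy), hwφ x hx x (mem_ball_self hδ)]
          exact (hφδ x hx y (ball_subset_ball hρ' hy)).1
      rw [hwφ x hx x (mem_ball_self hδ), Real.dist_eq] at h1
      linarith
    · refine norm_fderiv_mollify_sub_le ρ hwc _ hε.le x fun y hy z hz ↦ ?_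
      rw [hρ] at hy hz
      rw [hwφ x hx y hy, hwφ x hx z hz]
      refine (convex_ball x δ).norm_image_sub_le_of_norm_fderiv_le' (𝕜 := ℝ)
        (fun y _ ↦ hdiff y) (fun y hy ↦ ?_) hz hy
      linarith [(hφδ x hx y hy).2]
  obtain ⟨R, hR⟩ := hc.isBounded.subset_ball 0
  -- With this bound, the term `W ∇χ` of the product rule costs at most `ε / 2`.
  obtain ⟨χ, hχs, hχc, hχ1, hχR, hχd⟩ := exists_cutoff_fderiv_le (E := E) R
    (η := ε / 2 / (M + ε / 2)) (by positivity)
  have hχdiff : Differentiable ℝ χ := hχs.differentiable (by simp)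
  refine ⟨fun x ↦ χ x * W x, hχs.mul hWs, hχc.mul_right, fun x ↦ ?_, fun x ↦ ?_, fun x hx ↦ ?_⟩
  · rw [abs_mul]
    nlinarith [hχ1 x, hWM x, abs_nonneg (W x), abs_nonneg (χ x)]
  · rw [fderiv_fun_mul (hχdiff x) (hWd x)]
    have h1 : ‖χ x • fderiv ℝ W x‖ ≤ 1 * (L + ε / 2) := by
      rw [norm_smul]
      exact mul_le_mul (hχ1 x) (hWL x) (norm_nonneg _) zero_le_one
    have h2 : ‖W x • fderiv ℝ χ x‖ ≤ (M + ε / 2) * (ε / 2 / (M + ε / 2)) := by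
      rw [norm_smul]
      exact mul_le_mul (hWM x) (hχd x) (norm_nonneg _) hMε
    rw [mul_div_cancel₀ _ (by positivity)] at h2
    linarith [norm_add_le (χ x • fderiv ℝ W x) (W x • fderiv ℝ χ x)]
  · have heq : (fun x ↦ χ x * W x) =ᶠ[𝓝 x] W := by
      filter_upwards [isOpen_ball.mem_nhds (hR hx)] with y hy
      rw [hχR y hy, one_mul]
    have heq' := heq.eq_of_nhds
    beta_reduce at heq' ⊢
    rw [heq.fderiv_eq, heq']
    exact hWφ x hx

end Approximation

/-! ### Positive measures from one-sided bounds. -/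

section RieszExtension

open CompactlySupported

/-- A linear functional on `C(X)`, `X` compact, that is bounded by `a * sup F⁺` is given by a
positive measure of mass at most `a`. -/
theorem exists_measure_of_le_norm_sup_zero {X : Type*} [TopologicalSpace X] [CompactSpace X]
    [T2Space X] [MeasurableSpace X] [BorelSpace X] (Λ : C(X, ℝ) →ₗ[ℝ] ℝ) {a : ℝ} (ha : 0 ≤ a)
    (hΛ : ∀ F, Λ F ≤ a * ‖F ⊔ 0‖) :
    ∃ μ : Measure X, IsFiniteMeasure μ ∧ μ univ ≤ ENNReal.ofReal a ∧
      ∀ F : C(X, ℝ), ∫ x, F x ∂μ = Λ F := by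
  have hpos : ∀ F : C(X, ℝ), 0 ≤ F → 0 ≤ Λ F := by
    intro F hF
    have := hΛ (-F)
    rw [sup_of_le_right (neg_nonpos.2 hF), norm_zero, mul_zero, map_neg] at this
    linarith
  let Λ' : C_c(X, ℝ) →ₚ[ℝ] ℝ := PositiveLinearMap.mk₀
    { toFun := fun F ↦ Λ F.toContinuousMap
      map_add' := fun F G ↦ Λ.map_add F.toContinuousMap G.toContinuousMap
      map_smul' := fun c F ↦ Λ.map_smul c F.toContinuousMap }
    fun F hF ↦ hpos _ hF
  refine ⟨RealRMK.rieszMeasure Λ', inferInstance, ?_, fun F ↦ ?_⟩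
  · let o : C_c(X, ℝ) := ⟨1, HasCompactSupport.of_compactSpace 1⟩
    refine (RealRMK.rieszMeasure_le_of_eq_one Λ' (f := o) (fun x ↦ zero_le_one) isCompact_univ
      fun x _ ↦ rfl).trans (ENNReal.ofReal_le_ofReal ?_)
    change Λ 1 ≤ a
    refine (hΛ 1).trans ?_
    rw [sup_of_le_left (zero_le_one)]
    refine mul_le_of_le_one_right ha ?_
    rw [ContinuousMap.norm_le _ zero_le_one]
    simp
  · exact RealRMK.integral_rieszMeasure Λ' ⟨F, HasCompactSupport.of_compactSpace _⟩

theorem norm_add_sup_zero_le {X : Type*} [TopologicalSpace X] [CompactSpace X] (F G : C(X, ℝ)) :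
    ‖(F + G) ⊔ 0‖ ≤ ‖F ⊔ 0‖ + ‖G ⊔ 0‖ := by
  rw [ContinuousMap.norm_le _ (by positivity)]
  intro x
  have h1 := (F ⊔ 0).norm_coe_le_norm x
  have h2 := (G ⊔ 0).norm_coe_le_norm x
  simp only [ContinuousMap.sup_apply, ContinuousMap.zero_apply, ContinuousMap.add_apply,
    Real.norm_eq_abs, abs_of_nonneg (le_max_right _ (0 : ℝ))] at h1 h2 ⊢
  have := le_max_left (F x) 0
  have := le_max_left (G x) 0
  have := le_max_right (F x) 0
  have := le_max_right (G x) 0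
  exact max_le (by linarith) (by linarith)

theorem norm_smul_sup_zero {X : Type*} [TopologicalSpace X] [CompactSpace X] {c : ℝ} (hc : 0 < c)
    (F : C(X, ℝ)) : ‖(c • F) ⊔ 0‖ = c * ‖F ⊔ 0‖ := by
  have : (c • F) ⊔ 0 = c • (F ⊔ 0) := by
    ext x
    simp [mul_max_of_nonneg _ _ hc.le]
  rw [this, norm_smul, Real.norm_of_nonneg hc.le]

/-- A linear functional `ℓ` with `ℓ v ≤ a * sup (T v)⁺ + b * sup (S v)⁺` is the sum of the
integrals of `T v` and `S v` against positive measures of mass at most `a` and `b`. -/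
theorem exists_measures_of_le {V X Y : Type*} [AddCommGroup V] [Module ℝ V]
    [TopologicalSpace X] [CompactSpace X] [T2Space X] [MeasurableSpace X] [BorelSpace X]
    [TopologicalSpace Y] [CompactSpace Y] [T2Space Y] [MeasurableSpace Y] [BorelSpace Y]
    (T : V →ₗ[ℝ] C(X, ℝ)) (S : V →ₗ[ℝ] C(Y, ℝ)) (l : V →ₗ[ℝ] ℝ) {a b : ℝ} (ha : 0 ≤ a)
    (hb : 0 ≤ b) (hl : ∀ v, l v ≤ a * ‖T v ⊔ 0‖ + b * ‖S v ⊔ 0‖) :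
    ∃ (μ : Measure X) (ν : Measure Y), IsFiniteMeasure μ ∧ IsFiniteMeasure ν ∧
      μ univ ≤ ENNReal.ofReal a ∧ ∀ v, l v = ∫ x, T v x ∂μ + ∫ y, S v y ∂ν := by
  let p : C(X, ℝ) × C(Y, ℝ) → ℝ := fun F ↦ a * ‖F.1 ⊔ 0‖ + b * ‖F.2 ⊔ 0‖
  have hker : (T.prod S).ker ≤ l.ker := by
    intro v hv
    obtain ⟨h1, h2⟩ : T v = 0 ∧ S v = 0 := by simpa using hv
    have h3 := hl v
    have h4 := hl (-v)
    simp only [map_neg, h1, h2, neg_zero, sup_idem, norm_zero, mul_zero, add_zero] at h3 h4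
    exact le_antisymm h3 (by linarith)
  -- Since `l` vanishes on the kernel of `(T, S)`, it descends to the range as `l ∘ s`, whatever the
  -- section `s`.
  obtain ⟨s, hs⟩ := (T.prod S).rangeRestrict.exists_rightInverse_of_surjective
    (T.prod S).range_rangeRestrict
  have hls : ∀ v, l (s ((T.prod S).rangeRestrict v)) = l v := by
    intro v
    have h1 : s ((T.prod S).rangeRestrict v) - v ∈ (T.prod S).ker := by
      have h2 := LinearMap.congr_fun hs ((T.prod S).rangeRestrict v)
      rw [LinearMap.mem_ker, map_sub, sub_eq_zero]
      exact congrArg Subtype.val h2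
    have h3 := hker h1
    rwa [LinearMap.mem_ker, map_sub, sub_eq_zero] at h3
  obtain ⟨Λ, hΛ, hΛp⟩ := exists_extension_of_le_sublinear
    ⟨LinearMap.range (T.prod S), l ∘ₗ s⟩ p
    (fun c hc F ↦ by
      simp only [p, Prod.smul_fst, Prod.smul_snd, norm_smul_sup_zero hc]
      ring)
    (fun F G ↦ by
      have h1 := mul_le_mul_of_nonneg_left (norm_add_sup_zero_le F.1 G.1) ha
      have h2 := mul_le_mul_of_nonneg_left (norm_add_sup_zero_le F.2 G.2) hb
      simp only [p, Prod.fst_add, Prod.snd_add]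
      linarith)
    (by
      rintro ⟨_, v, rfl⟩
      exact (hls v).trans_le (hl v))
  obtain ⟨μ, hμ, hμa, hμΛ⟩ := exists_measure_of_le_norm_sup_zero (Λ ∘ₗ LinearMap.inl ℝ _ _) ha
    fun F ↦ by simpa [p] using hΛp (F, 0)
  obtain ⟨ν, hν, -, hνΛ⟩ := exists_measure_of_le_norm_sup_zero (Λ ∘ₗ LinearMap.inr ℝ _ _) hb
    fun F ↦ by simpa [p] using hΛp (0, F)
  refine ⟨μ, ν, hμ, hν, hμa, fun v ↦ ?_⟩
  rw [hμΛ, hνΛ, LinearMap.comp_apply, LinearMap.comp_apply, ← map_add, ← hls v]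
  have := hΛ ((T.prod S).rangeRestrict v)
  simpa using this.symm

end RieszExtension

/-! ### The pairing as a continuous extension. -/

section Pairing

variable {N : ℕ} {Ω : Set (Space N)}

theorem Test.contDiff_one (φ : Test N) : ContDiff ℝ 1 φ :=
  φ.contDiff.of_le (by exact_mod_cast le_top)

theorem Test.differentiable (φ : Test N) : Differentiable ℝ φ :=
  φ.contDiff_one.differentiable (by simp)

theorem Test.continuous_fderiv (φ : Test N) : Continuous (fderiv ℝ φ) :=
  φ.contDiff_one.continuous_fderiv (by simp)

theorem Test.fderiv_sub (φ ψ : Test N) (x : Space N) :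
    fderiv ℝ (φ - ψ : Test N) x = fderiv ℝ φ x - fderiv ℝ ψ x := by
  rw [FunLike.coe_sub]
  exact _root_.fderiv_sub (φ.differentiable x) (ψ.differentiable x)

theorem Test.fderiv_add (φ ψ : Test N) (x : Space N) :
    fderiv ℝ (φ + ψ : Test N) x = fderiv ℝ φ x + fderiv ℝ ψ x := by
  rw [FunLike.coe_add]
  exact _root_.fderiv_add (φ.differentiable x) (ψ.differentiable x)

theorem Test.fderiv_smul (c : ℝ) (φ : Test N) (x : Space N) :
    fderiv ℝ (c • φ : Test N) x = c • fderiv ℝ φ x := by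
  rw [FunLike.coe_smul]
  exact fderiv_const_smul (φ.differentiable x) c

theorem Test.isC10 (φ : Test N) : IsC10 φ :=
  ⟨φ.contDiff_one, φ.hasCompactSupport.is_zero_at_infty,
    (φ.hasCompactSupport.fderiv ℝ).is_zero_at_infty⟩

theorem norm_le_supNormOn {F : Type*} [NormedAddCommGroup F] (hc : IsCompact Ω)
    {g : Space N → F} (hg : Continuous g) {x : Space N} (hx : x ∈ Ω) : ‖g x‖ ≤ supNormOn Ω g := by
  have h := (hc.image hg.norm).bddAbove
  refine le_ciSup (f := fun x : Ω ↦ ‖g x‖) (h.mono ?_) ⟨x, hx⟩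
  rintro _ ⟨y, rfl⟩
  exact ⟨y, y.2, rfl⟩

theorem supNormOn_le {F : Type*} [NormedAddCommGroup F] {g : Space N → F} {C : ℝ} (hC : 0 ≤ C)
    (h : ∀ x ∈ Ω, ‖g x‖ ≤ C) : supNormOn Ω g ≤ C :=
  Real.iSup_le (fun x ↦ h x x.2) hC

theorem supNormOn_nonneg {F : Type*} [NormedAddCommGroup F] (g : Space N → F) :
    0 ≤ supNormOn Ω g :=
  Real.iSup_nonneg fun _ ↦ norm_nonneg _

theorem supNormOn_neg {F : Type*} [NormedAddCommGroup F] (g : Space N → F) :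
    supNormOn Ω (-g) = supNormOn Ω g := by
  simp [supNormOn]

theorem X0.exists_abs_le {f : Distr N} (hf : f ∈ X0 Ω) :
    ∃ C : ℝ, 0 ≤ C ∧ ∀ φ : Test N,
      |f φ| ≤ C * (supNormOn Ω φ + supNormOn Ω (fderiv ℝ φ)) := by
  obtain ⟨⟨C, hC⟩, -⟩ := hf
  refine ⟨|C|, abs_nonneg C, fun φ ↦ ?_⟩
  have h0 : 0 ≤ supNormOn Ω φ + supNormOn Ω (fderiv ℝ φ) :=
    add_nonneg (supNormOn_nonneg _) (supNormOn_nonneg _)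
  have h1 := hC φ
  have h2 := hC (-φ)
  have h3 : fderiv ℝ (-φ : Test N) = -fderiv ℝ φ := by
    ext1 x
    rw [FunLike.coe_neg, fderiv_neg, Pi.neg_apply]
  rw [map_neg, h3, FunLike.coe_neg, supNormOn_neg, supNormOn_neg] at h2
  have h4 := mul_le_mul_of_nonneg_right (le_abs_self C) h0
  exact abs_le.2 ⟨by linarith, by linarith⟩

theorem X0.sub {f g : Distr N} (hf : f ∈ X0 Ω) (hg : g ∈ X0 Ω) : f - g ∈ X0 Ω := by
  obtain ⟨C, -, hC⟩ := X0.exists_abs_le hf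
  obtain ⟨C', -, hC'⟩ := X0.exists_abs_le hg
  refine ⟨⟨C + C', fun φ ↦ ?_⟩, fun φ hφ ↦ ?_⟩
  · have h1 := abs_le.1 (hC φ)
    have h2 := abs_le.1 (hC' φ)
    change f φ - g φ ≤ _
    linarith [h1.2, h2.1]
  · change f φ - g φ = 0
    rw [hf.2 φ hφ, hg.2 φ hφ, sub_zero]

theorem exists_test_approx (hΩ : Convex ℝ Ω) (hc : IsCompact Ω) {φ : Space N → ℝ}
    (hφ : ContDiff ℝ 1 φ) {ε : ℝ} (hε : 0 < ε) :
    ∃ u : Test N, (∀ x, |u x| ≤ supNormOn Ω φ + ε) ∧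
      (∀ x, ‖fderiv ℝ u x‖ ≤ supNormOn Ω (fderiv ℝ φ) + ε) ∧
      ∀ x ∈ Ω, |u x - φ x| ≤ ε ∧ ‖fderiv ℝ u x - fderiv ℝ φ x‖ ≤ ε := by
  obtain ⟨u, hu, huc, h⟩ := exists_contDiff_approx hΩ hc hφ (supNormOn_nonneg _)
    (supNormOn_nonneg _) (fun x hx ↦ norm_le_supNormOn hc hφ.continuous hx)
    (fun x hx ↦ norm_le_supNormOn hc (hφ.continuous_fderiv (by simp)) hx) hε
  exact ⟨⟨u, hu, huc, subset_univ _⟩, h⟩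

theorem hasBasis_c1Approach (Ω : Set (Space N)) (u : Space N → ℝ) :
    (c1Approach Ω u).HasBasis (fun ε : ℝ ↦ 0 < ε) fun ε ↦
      {φ : Test N | ∀ x ∈ Ω, |φ x - u x| ≤ ε ∧ ‖fderiv ℝ φ x - fderiv ℝ u x‖ ≤ ε} := by
  refine hasBasis_biInf_principal ?_ ⟨1, mem_Ioi.2 one_pos⟩
  intro a ha b hb
  refine ⟨min a b, mem_Ioi.2 (lt_min ha hb), fun φ hφ x hx ↦ ?_, fun φ hφ x hx ↦ ?_⟩
  · exact ⟨(hφ x hx).1.trans (min_le_left _ _), (hφ x hx).2.trans (min_le_left _ _)⟩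
  · exact ⟨(hφ x hx).1.trans (min_le_right _ _), (hφ x hx).2.trans (min_le_right _ _)⟩

theorem c1Approach_neBot (hΩ : Convex ℝ Ω) (hc : IsCompact Ω) {u : Space N → ℝ}
    (hu : ContDiff ℝ 1 u) : (c1Approach Ω u).NeBot := by
  refine (hasBasis_c1Approach Ω u).neBot_iff.2 fun {ε} hε ↦ ?_
  obtain ⟨φ, -, -, h⟩ := exists_test_approx hΩ hc hu hε
  exact ⟨φ, h⟩

/-- `limUnder` is meaningful only when a limit exists. The order-one bound makes the values of `f`
Cauchy along the filter, which is nontrivial by approximation. -/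
theorem tendsto_pairing (hΩ : Convex ℝ Ω) (hc : IsCompact Ω) {f : Distr N} (hf : f ∈ X0 Ω)
    {u : Space N → ℝ} (hu : ContDiff ℝ 1 u) :
    Tendsto (fun φ : Test N ↦ f φ) (c1Approach Ω u) (𝓝 (pairing Ω f u)) := by
  have hne := c1Approach_neBot hΩ hc hu
  refine tendsto_nhds_limUnder (cauchy_map_iff_exists_tendsto.1 ?_)
  obtain ⟨C, hC0, hC⟩ := X0.exists_abs_le hf
  refine Metric.cauchy_iff.2 ⟨inferInstance, fun ε hε ↦ ?_⟩
  set η : ℝ := ε / (4 * C + 1) / 2 with hη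
  have hη0 : 0 < η := by positivity
  refine ⟨_, image_mem_map ((hasBasis_c1Approach Ω u).mem_of_mem hη0), ?_⟩
  rintro _ ⟨φ, hφ, rfl⟩ _ ⟨ψ, hψ, rfl⟩
  rw [Real.dist_eq, ← map_sub]
  have h1 : supNormOn Ω (φ - ψ : Test N) ≤ 2 * η := by
    refine supNormOn_le (by positivity) fun x hx ↦ ?_
    have h1 := abs_le.1 (hφ x hx).1
    have h2 := abs_le.1 (hψ x hx).1
    rw [FunLike.coe_sub, Pi.sub_apply, Real.norm_eq_abs]
    exact abs_le.2 ⟨by linarith, by linarith⟩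
  have h2 : supNormOn Ω (fderiv ℝ (φ - ψ : Test N)) ≤ 2 * η := by
    refine supNormOn_le (by positivity) fun x hx ↦ ?_
    rw [Test.fderiv_sub, ← sub_sub_sub_cancel_right _ _ (fderiv ℝ u x)]
    have := norm_sub_le (fderiv ℝ φ x - fderiv ℝ u x) (fderiv ℝ ψ x - fderiv ℝ u x)
    linarith [(hφ x hx).2, (hψ x hx).2]
  calc |f (φ - ψ)| ≤ C * (2 * η + 2 * η) := (hC _).trans (by gcongr)
    _ = C * 4 / (4 * C + 1) / 2 * ε := by rw [hη]; ring
    _ < 1 * ε := by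
      gcongr
      rw [div_div, div_lt_one (by positivity)]
      linarith
    _ = ε := one_mul ε

theorem pure_le_c1Approach (φ : Test N) : pure φ ≤ c1Approach Ω φ :=
  (hasBasis_c1Approach Ω φ).ge_iff.2 fun ε hε ↦ mem_pure.2 fun x _ ↦ by simp [hε.le]

theorem pairing_test (hΩ : Convex ℝ Ω) (hc : IsCompact Ω) {f : Distr N} (hf : f ∈ X0 Ω)
    (φ : Test N) : pairing Ω f φ = f φ :=
  tendsto_nhds_unique ((tendsto_pairing hΩ hc hf φ.contDiff_one).mono_left
    (pure_le_c1Approach φ)) (tendsto_pure_nhds _ _)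

end Pairing

/-! ### Infinitesimal, short and long steps. -/

section Slice

variable {N : ℕ} {Ω : Set (Space N)}

theorem le_of_forall_pos_le_add_mul {a A B : ℝ} (h : ∀ ε > 0, a ≤ A + ε * B) : a ≤ A := by
  have h1 : Tendsto (fun ε : ℝ ↦ A + ε * B) (𝓝[>] 0) (𝓝 (A + 0 * B)) :=
    ((continuous_const.add (continuous_id.mul continuous_const)).tendsto 0).mono_left
      nhdsWithin_le_nhds
  rw [zero_mul, add_zero] at h1
  exact ge_of_tendsto h1 (eventually_mem_nhdsWithin.mono h)

/-- Multiples of `χ` stand in for constants, which need not have compact support. -/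
theorem exists_test_eq_one (hc : IsCompact Ω) :
    ∃ χ : Test N, ∀ x ∈ Ω, χ x = 1 ∧ fderiv ℝ χ x = 0 := by
  obtain ⟨R, hR⟩ := hc.isBounded.subset_ball 0
  obtain ⟨χ, hχ, hχc, -, hχR, -⟩ := exists_cutoff_fderiv_le (E := Space N) R one_pos
  refine ⟨⟨χ, hχ, hχc, subset_univ _⟩, fun x hx ↦ ⟨hχR x (hR hx), ?_⟩⟩
  have heq : χ =ᶠ[𝓝 x] fun _ ↦ 1 := by
    filter_upwards [isOpen_ball.mem_nhds (hR hx)] with y hy using hχR y hy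
  exact heq.fderiv_eq.trans (fderiv_const_apply _)

theorem norm_direction (p : Phase Ω) : ‖(p.2.1 : Space N)‖ = 1 := by
  simp

theorem abs_apply_direction_le (A : Space N →L[ℝ] ℝ) (p : Phase Ω) : |A p.2.1| ≤ ‖A‖ := by
  simpa using A.le_opNorm (p.2.1 : Space N)

theorem continuous_fderiv_direction {u : Space N → ℝ} (hu : Continuous (fderiv ℝ u)) :
    Continuous fun p : Phase Ω ↦ fderiv ℝ u p.1 p.2.1 :=
  (hu.comp (continuous_subtype_val.comp continuous_fst)).clm_apply
    (continuous_subtype_val.comp (continuous_fst.comp continuous_snd))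

/-- The distribution `φ ↦ ∫ ∇φ(x) · v dν`. -/
noncomputable def directionalDistr (ν : Measure (Phase Ω)) [IsFiniteMeasure ν] : Distr N :=
  ((LinearMap.mkContinuous
    { toFun := fun F : BoundedContinuousFunction (Space N) (Space N →L[ℝ] ℝ) ↦
        ∫ p : Phase Ω, F p.1 p.2.1 ∂ν
      map_add' := fun F G ↦ by
        have hi (F : BoundedContinuousFunction (Space N) (Space N →L[ℝ] ℝ)) :
            Integrable (fun p : Phase Ω ↦ F p.1 p.2.1) ν :=
          .of_bound ((F.continuous.comp (continuous_subtype_val.comp continuous_fst)).clm_apply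
            (continuous_subtype_val.comp
              (continuous_fst.comp continuous_snd))).aestronglyMeasurable ‖F‖
            (.of_forall fun p ↦ (abs_apply_direction_le _ p).trans (F.norm_coe_le_norm _))
        exact integral_add (hi F) (hi G)
      map_smul' := fun c F ↦ integral_const_mul c _ }
    (ν.real univ) fun F ↦ by
      rw [mul_comm]
      exact norm_integral_le_of_norm_le_const
        (.of_forall fun p ↦ (abs_apply_direction_le _ p).trans (F.norm_coe_le_norm _))) ∘L
    (TestFunction.toBoundedContinuousFunctionCLM ℝ) ∘L
    (TestFunction.fderivCLM ℝ (⊤ : ℕ∞) (⊤ : ℕ∞)) : Test N →L[ℝ] ℝ)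

theorem directionalDistr_apply (ν : Measure (Phase Ω)) [IsFiniteMeasure ν] (φ : Test N) :
    directionalDistr ν φ = ∫ p : Phase Ω, fderiv ℝ φ p.1 p.2.1 ∂ν := by
  change ∫ p : Phase Ω, (TestFunction.fderivCLM ℝ (⊤ : ℕ∞) (⊤ : ℕ∞) φ) p.1 p.2.1 ∂ν = _
  simp

theorem abs_directionalDistr_le (ν : Measure (Phase Ω)) [IsFiniteMeasure ν] (φ : Test N) {L : ℝ}
    (hL : ∀ x ∈ Ω, ‖fderiv ℝ φ x‖ ≤ L) : |directionalDistr ν φ| ≤ L * ν.real univ := by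
  have h : ∀ p : Phase Ω, ‖fderiv ℝ φ p.1 p.2.1‖ ≤ L := fun p ↦
    (abs_apply_direction_le _ p).trans (hL _ p.1.2)
  rw [directionalDistr_apply]
  exact norm_integral_le_of_norm_le_const (.of_forall h)

theorem measurableSet_slice : MeasurableSet {p : Phase Ω | (p.2.2 : ℝ) = 0} :=
  (measurable_subtype_coe.comp (measurable_snd.comp measurable_snd)) (measurableSet_singleton 0)

theorem measurable_diffQuot {u : Space N → ℝ} (hu : ContDiff ℝ 1 u) :
    Measurable fun p : Phase Ω ↦ diffQuot u (p.1 : Space N) (p.2.1 : Space N) (p.2.2 : ℝ) := by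
  refine Measurable.ite measurableSet_slice
    (continuous_fderiv_direction (hu.continuous_fderiv (by simp))).measurable ?_
  have hx : Continuous fun p : Phase Ω ↦ (p.1 : Space N) := by fun_prop
  have hv : Continuous fun p : Phase Ω ↦ (p.2.1 : Space N) := by fun_prop
  have ht : Continuous fun p : Phase Ω ↦ (p.2.2 : ℝ) := by fun_prop
  have hu' := hu.continuous
  exact Measurable.div ((hu'.comp (hx.add (ht.smul hv))).sub (hu'.comp hx)).measurable ht.measurable

theorem abs_diffQuot_le_of_fderiv_le {u : Space N → ℝ} (hu : Differentiable ℝ u) {L : ℝ}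
    (hL : ∀ x, ‖fderiv ℝ u x‖ ≤ L) (p : Phase Ω) :
    |diffQuot u (p.1 : Space N) (p.2.1 : Space N) (p.2.2 : ℝ)| ≤ L := by
  have ht : (0 : ℝ) ≤ p.2.2 := p.2.2.2
  rw [diffQuot]
  split_ifs with h
  · exact (abs_apply_direction_le _ p).trans (hL _)
  · rw [abs_div, div_le_iff₀ (by positivity), abs_of_nonneg ht]
    have := convex_univ.norm_image_sub_le_of_norm_fderiv_le (𝕜 := ℝ) (fun x _ ↦ hu x)
      (fun x _ ↦ hL x) (mem_univ (p.1 : Space N)) (mem_univ (p.1 + (p.2.2 : ℝ) • (p.2.1 : Space N)))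
    rw [add_sub_cancel_left, norm_smul, norm_direction, mul_one, Real.norm_of_nonneg ht] at this
    exact this

theorem abs_diffQuot_le_of_abs_le {u : Space N → ℝ} {M d : ℝ} (hd : 0 < d)
    (hM : ∀ x, |u x| ≤ M) (p : Phase Ω) (hp : d ≤ p.2.2) :
    |diffQuot u (p.1 : Space N) (p.2.1 : Space N) (p.2.2 : ℝ)| ≤ 2 * M / d := by
  have ht : (0 : ℝ) < p.2.2 := hd.trans_le hp
  have hM0 : 0 ≤ M := (abs_nonneg _).trans (hM 0)
  rw [diffQuot, if_neg ht.ne', abs_div, abs_of_pos ht]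
  gcongr
  have := abs_sub (u (p.1 + (p.2.2 : ℝ) • (p.2.1 : Space N))) (u p.1)
  linarith [hM (p.1 + (p.2.2 : ℝ) • (p.2.1 : Space N)), hM p.1]

theorem integrable_diffQuot (σ : Measure (Phase Ω)) [IsFiniteMeasure σ] (φ : Test N) :
    Integrable (fun p : Phase Ω ↦
      diffQuot φ (p.1 : Space N) (p.2.1 : Space N) (p.2.2 : ℝ)) σ := by
  obtain ⟨L, hL⟩ := φ.continuous_fderiv.bounded_above_of_compact_support
    (φ.hasCompactSupport.fderiv ℝ)
  exact .of_bound (measurable_diffQuot φ.contDiff_one).aestronglyMeasurable L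
    (.of_forall (abs_diffQuot_le_of_fderiv_le φ.differentiable hL))

instance (σ : Measure (Phase Ω)) [IsFiniteMeasure σ] : IsFiniteMeasure (slice0 σ) :=
  inferInstanceAs (IsFiniteMeasure (σ.restrict _))

/-- The points of the phase space with a positive step smaller than `d`. -/
def shortSteps (Ω : Set (Space N)) (d : ℝ) : Set (Phase Ω) :=
  {p | 0 < (p.2.2 : ℝ) ∧ (p.2.2 : ℝ) < d}

theorem measurableSet_shortSteps (d : ℝ) : MeasurableSet (shortSteps Ω d) :=
  (measurable_subtype_coe.comp (measurable_snd.comp measurable_snd))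
    (measurableSet_Ioo (a := (0 : ℝ)) (b := d))

/-- The sets decrease to the empty set because `t = 0` is excluded, and `σ` is finite. -/
theorem exists_measureReal_shortSteps_le (σ : Measure (Phase Ω)) [IsFiniteMeasure σ] {ε : ℝ}
    (hε : 0 < ε) : ∃ d > 0, σ.real (shortSteps Ω d) ≤ ε := by
  have h1 : Tendsto (fun n : ℕ ↦ σ (shortSteps Ω (1 / ((n : ℝ) + 1)))) atTop
      (𝓝 (σ (⋂ n : ℕ, shortSteps Ω (1 / ((n : ℝ) + 1))))) := by
    refine tendsto_measure_iInter_atTop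
      (fun n ↦ (measurableSet_shortSteps _).nullMeasurableSet) ?_ ⟨0, measure_ne_top _ _⟩
    intro m n hmn p hp
    exact ⟨hp.1, hp.2.trans_le (one_div_le_one_div_of_le (by positivity) (by gcongr))⟩
  have h2 : (⋂ n : ℕ, shortSteps Ω (1 / ((n : ℝ) + 1))) = ∅ := by
    refine eq_empty_of_forall_notMem fun p hp ↦ ?_
    rw [mem_iInter] at hp
    obtain ⟨n, hn⟩ := exists_nat_one_div_lt (hp 0).1
    exact lt_asymm hn (hp n).2
  rw [h2, measure_empty] at h1
  obtain ⟨n, hn⟩ := (h1.eventually (gt_mem_nhds (ENNReal.ofReal_pos.2 hε))).exists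
  exact ⟨1 / ((n : ℝ) + 1), by positivity, ENNReal.toReal_le_of_le_ofReal hε.le hn.le⟩

/-- The estimate behind `f - ∫ ∇φ(x) · v dσ₀ ∈ X₀^♯(Ω)`, for functions controlled on the whole
space. -/
theorem abs_sub_directionalDistr_le {f : Distr N} {σ : Measure (Phase Ω)} [IsFiniteMeasure σ]
    {φ : Test N}
    (hσ : ∫ p, diffQuot φ (p.1 : Space N) (p.2.1 : Space N) (p.2.2 : ℝ) ∂σ = f φ)
    {L M d : ℝ} (hd : 0 < d) (hM : ∀ x, |φ x| ≤ M) (hL : ∀ x, ‖fderiv ℝ φ x‖ ≤ L) :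
    |f φ - directionalDistr (slice0 σ) φ| ≤
      L * σ.real (shortSteps Ω d) + 2 * M / d * σ.real univ := by
  have hL0 : 0 ≤ L := (norm_nonneg _).trans (hL 0)
  have hM0 : 0 ≤ M := (abs_nonneg _).trans (hM 0)
  set S : Set (Phase Ω) := {p : Phase Ω | (p.2.2 : ℝ) = 0} with hS
  have h1 : f φ - directionalDistr (slice0 σ) φ =
      ∫ p in Sᶜ, diffQuot φ (p.1 : Space N) (p.2.1 : Space N) (p.2.2 : ℝ) ∂σ := by
    rw [← hσ, ← integral_add_compl measurableSet_slice (integrable_diffQuot σ φ),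
      directionalDistr_apply, slice0]
    have : ∫ p in S, diffQuot φ (p.1 : Space N) (p.2.1 : Space N) (p.2.2 : ℝ) ∂σ =
        ∫ p in S, fderiv ℝ φ p.1 p.2.1 ∂σ :=
      setIntegral_congr_fun measurableSet_slice fun p hp ↦ if_pos hp
    rw [this, add_sub_cancel_left]
  have hi : Integrable ((shortSteps Ω d).indicator fun _ : Phase Ω ↦ L) σ :=
    (integrable_const L).indicator (measurableSet_shortSteps d)
  have hi2 : Integrable (fun p : Phase Ω ↦ (shortSteps Ω d).indicator (fun _ ↦ L) p + 2 * M / d) σ :=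
    hi.add (integrable_const _)
  have h0 : ∀ p : Phase Ω, 0 ≤ (shortSteps Ω d).indicator (fun _ ↦ L) p + 2 * M / d := fun p ↦
    add_nonneg (indicator_nonneg (fun _ _ ↦ hL0) p) (by positivity)
  rw [h1, ← Real.norm_eq_abs]
  -- The Lipschitz bound `L` serves for steps shorter than `d`, the sup bound for the others.
  calc _ ≤ ∫ p in Sᶜ, ((shortSteps Ω d).indicator (fun _ ↦ L) p + 2 * M / d) ∂σ := by
        refine norm_integral_le_of_norm_le hi2.integrableOn
          ((ae_restrict_iff' measurableSet_slice.compl).2 (.of_forall fun p hp ↦ ?_))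
        rw [Real.norm_eq_abs]
        have hp0 : 0 < (p.2.2 : ℝ) := lt_of_le_of_ne p.2.2.2 (Ne.symm hp)
        by_cases hpd : (p.2.2 : ℝ) < d
        · rw [indicator_of_mem (show p ∈ shortSteps Ω d from ⟨hp0, hpd⟩)]
          have := abs_diffQuot_le_of_fderiv_le φ.differentiable hL p
          have : 0 ≤ 2 * M / d := by positivity
          linarith
        · rw [indicator_of_notMem (show p ∉ shortSteps Ω d from fun h ↦ hpd h.2), zero_add]
          exact abs_diffQuot_le_of_abs_le hd hM p (not_lt.1 hpd)
    _ ≤ ∫ p, ((shortSteps Ω d).indicator (fun _ ↦ L) p + 2 * M / d) ∂σ :=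
        setIntegral_le_integral hi2 (.of_forall h0)
    _ = _ := by
        rw [integral_add hi (integrable_const _), integral_indicator (measurableSet_shortSteps d)]
        simp [mul_comm]

end Slice

/-! ### The distance is at most the mass of any slice. -/

section UpperBound

variable {N : ℕ} {Ω : Set (Space N)}

/-- The estimate behind `f - ∫ ∇φ(x) · v dσ₀ ∈ X₀^♯(Ω)`. -/
theorem abs_sub_directionalDistr_le_supNormOn (hΩ : Convex ℝ Ω) (hc : IsCompact Ω) {f : Distr N}
    (hf : f ∈ X0 Ω) {σ : Measure (Phase Ω)} [IsFiniteMeasure σ]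
    (hσ : ∀ φ : Test N,
      ∫ p, diffQuot φ (p.1 : Space N) (p.2.1 : Space N) (p.2.2 : ℝ) ∂σ = f φ)
    (φ : Test N) {d : ℝ} (hd : 0 < d) :
    |(f - directionalDistr (slice0 σ)) φ| ≤
      supNormOn Ω (fderiv ℝ φ) * σ.real (shortSteps Ω d) +
        2 * supNormOn Ω φ / d * σ.real univ := by
  obtain ⟨C, hC0, hC⟩ := X0.exists_abs_le hf
  set G := directionalDistr (slice0 σ)
  refine le_of_forall_pos_le_add_mul
    (B := σ.real (shortSteps Ω d) + 2 / d * σ.real univ + C * 2 + (slice0 σ).real univ)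
    fun ε hε ↦ ?_
  -- The previous estimate needs global bounds, so it is applied to `u`. Both `f` and `G` are
  -- continuous in C¹(Ω), so the replacement costs a multiple of `ε`.
  obtain ⟨u, huM, huL, hu⟩ := exists_test_approx hΩ hc φ.contDiff_one hε
  have h1 := abs_sub_directionalDistr_le (hσ u) hd huM huL
  have h2 : |f (φ - u)| ≤ C * (ε + ε) := by
    refine (hC _).trans ?_
    gcongr
    · refine supNormOn_le hε.le fun x hx ↦ ?_
      rw [FunLike.coe_sub, Pi.sub_apply, norm_sub_rev]
      exact (hu x hx).1
    · refine supNormOn_le hε.le fun x hx ↦ ?_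
      rw [Test.fderiv_sub, norm_sub_rev]
      exact (hu x hx).2
  have h3 : |G (φ - u)| ≤ ε * (slice0 σ).real univ := by
    refine abs_directionalDistr_le _ _ fun x hx ↦ ?_
    rw [Test.fderiv_sub, norm_sub_rev]
    exact (hu x hx).2
  rw [map_sub] at h2 h3
  change |f φ - G φ| ≤ _
  have h4 : |f φ - G φ| ≤ |f u - G u| + |f φ - f u| + |G φ - G u| := by
    calc |f φ - G φ| = |(f u - G u) + (f φ - f u) - (G φ - G u)| := by ring_nf
      _ ≤ |(f u - G u) + (f φ - f u)| + |G φ - G u| := abs_sub _ _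
      _ ≤ _ := by gcongr; exact abs_add_le _ _
  calc _ ≤ _ := h4
    _ ≤ _ := add_le_add (add_le_add h1 h2) h3
    _ = _ := by ring

theorem sub_directionalDistr_mem_X0sharp (hΩ : Convex ℝ Ω) (hc : IsCompact Ω) {f : Distr N}
    (hf : f ∈ X0 Ω) {σ : Measure (Phase Ω)} [IsFiniteMeasure σ]
    (hσ : ∀ φ : Test N,
      ∫ p, diffQuot φ (p.1 : Space N) (p.2.1 : Space N) (p.2.2 : ℝ) ∂σ = f φ) :
    f - directionalDistr (slice0 σ) ∈ X0sharp Ω := by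
  have key := fun (φ : Test N) (d : ℝ) (hd : 0 < d) ↦
    abs_sub_directionalDistr_le_supNormOn hΩ hc hf hσ φ hd
  set g := f - directionalDistr (slice0 σ)
  have hsharp : ∀ ε : ℝ, 0 < ε → ∃ Cε : ℝ, 0 < Cε ∧ ∀ φ : Test N,
      |g φ| ≤ Cε * supNormOn Ω φ + ε * supNormOn Ω (fderiv ℝ φ) := by
    intro ε hε
    obtain ⟨d, hd, hdε⟩ := exists_measureReal_shortSteps_le σ hε
    refine ⟨2 / d * σ.real univ + 1, by positivity, fun φ ↦ (key φ d hd).trans ?_⟩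
    have h1 := mul_le_mul_of_nonneg_left hdε (supNormOn_nonneg (Ω := Ω) (fderiv ℝ φ))
    have h2 := supNormOn_nonneg (Ω := Ω) φ
    have h3 : 2 * supNormOn Ω φ / d * σ.real univ = 2 / d * σ.real univ * supNormOn Ω φ := by ring
    rw [h3]
    linarith
  refine ⟨⟨?_, ?_⟩, hsharp⟩
  · obtain ⟨C, hC0, hC⟩ := hsharp 1 one_pos
    refine ⟨C + 1, fun φ ↦ (le_abs_self _).trans ((hC φ).trans ?_)⟩
    have h2 := supNormOn_nonneg (Ω := Ω) φ
    have h3 := mul_nonneg hC0.le (supNormOn_nonneg (Ω := Ω) (fderiv ℝ φ))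
    linarith
  · rintro φ ⟨c, hφ⟩
    obtain ⟨χ, hχ⟩ := exists_test_eq_one hc
    -- The gradient of `χ` vanishes on `Ω`, so only the long-step bound remains, and it tends to 0
    -- as `d = ε⁻¹` grows.
    have h1 : g χ = 0 := by
      refine abs_nonpos_iff.1 (le_of_forall_pos_le_add_mul (B := 2 * σ.real univ) fun ε hε ↦ ?_)
      refine (key χ ε⁻¹ (inv_pos.2 hε)).trans ?_
      have h2 : supNormOn Ω (fderiv ℝ χ) = 0 :=
        le_antisymm (supNormOn_le le_rfl fun x hx ↦ by rw [(hχ x hx).2, norm_zero])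
          (supNormOn_nonneg _)
      have h3 : supNormOn Ω χ ≤ 1 :=
        supNormOn_le zero_le_one fun x hx ↦ by rw [(hχ x hx).1, norm_one]
      rw [h2, zero_mul, zero_add, zero_add, div_inv_eq_mul]
      calc _ ≤ 2 * 1 * ε * σ.real univ := by gcongr
        _ = _ := by ring
    -- This function vanishes on `Ω`, but its gradient need not if `Ω` has empty interior; the
    -- short-step mass in front of it is arbitrarily small.
    have h2 : g (φ - c • χ) = 0 := by
      refine abs_nonpos_iff.1 (le_of_forall_pos_le_add_mul
        (B := supNormOn Ω (fderiv ℝ (φ - c • χ : Test N))) fun ε hε ↦ ?_)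
      obtain ⟨d, hd, hdε⟩ := exists_measureReal_shortSteps_le σ hε
      refine (key _ d hd).trans ?_
      have h3 : supNormOn Ω (φ - c • χ : Test N) = 0 := by
        refine le_antisymm (supNormOn_le le_rfl fun x hx ↦ ?_) (supNormOn_nonneg _)
        rw [FunLike.coe_sub, FunLike.coe_smul, Pi.sub_apply, Pi.smul_apply, hφ x hx, (hχ x hx).1]
        simp
      rw [h3, mul_zero, zero_div, zero_mul, add_zero, zero_add, mul_comm]
      exact mul_le_mul_of_nonneg_right hdε (supNormOn_nonneg _)
    rwa [map_sub, map_smul, h1, smul_zero, sub_zero] at h2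

theorem distX0sharp_le (hΩ : Convex ℝ Ω) (hc : IsCompact Ω) {f : Distr N} (hf : f ∈ X0 Ω)
    {σ : Measure (Phase Ω)} (hσ : σ ∈ admissible Ω f) :
    distX0sharp Ω f ≤ ((slice0 σ univ : ENNReal) : EReal) := by
  have := hσ.1
  have hg := sub_directionalDistr_mem_X0sharp hΩ hc hf (σ := σ) fun φ ↦
    (hσ.2 φ φ.isC10).trans (pairing_test hΩ hc hf φ)
  refine (iInf₂_le _ hg).trans (iSup₂_le fun u hu ↦ ?_)
  rw [← EReal.coe_ennreal_toReal (measure_ne_top _ _), EReal.coe_le_coe_iff]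
  change _ ≤ (slice0 σ).real univ
  refine le_of_forall_pos_le_add_mul (B := (slice0 σ).real univ) fun ε hε ↦ ?_
  have := c1Approach_neBot hΩ hc hu.1.1
  refine le_of_tendsto (tendsto_pairing hΩ hc (X0.sub hf hg.1) hu.1.1) ?_
  -- Test functions `ε`-close to `u` have gradient at most `1 + ε` on `Ω`, which is all that
  -- `directionalDistr` sees.
  filter_upwards [(hasBasis_c1Approach Ω u).mem_of_mem hε] with φ hφ
  have h1 : (f - (f - directionalDistr (slice0 σ))) φ = directionalDistr (slice0 σ) φ :=
    sub_sub_cancel (f φ) (directionalDistr (slice0 σ) φ)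
  rw [h1]
  have h2 := abs_directionalDistr_le (slice0 σ) φ (L := 1 + ε) fun x hx ↦ by
    have := norm_sub_norm_le (fderiv ℝ φ x) (fderiv ℝ u x)
    linarith [(hφ x hx).2, hu.2 x]
  linarith [le_abs_self (directionalDistr (slice0 σ) φ)]

end UpperBound

/-! ### Construction of nearly optimal measures. -/

section LowerBound

variable {N : ℕ} {Ω : Set (Space N)}

theorem W1_nonneg (hΩ : Convex ℝ Ω) (hc : IsCompact Ω) {h : Distr N} (hh : h ∈ X0 Ω) :
    0 ≤ W1 Ω h := by
  have h0 : pairing Ω h (0 : Test N) = 0 := by rw [pairing_test hΩ hc hh, map_zero]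
  calc (0 : EReal) = ((pairing Ω h (0 : Test N) : ℝ) : EReal) := by rw [h0, EReal.coe_zero]
    _ ≤ W1 Ω h := le_iSup₂_of_le ((0 : Test N) : Space N → ℝ)
      ⟨(0 : Test N).isC10, fun x ↦ by simp [FunLike.coe_zero]⟩ le_rfl

/-- The competitors in `W1` have gradient at most 1 everywhere. The approximant `u` has global
gradient at most `L + ε`, so `u / (L + ε)` competes, even when `L = 0`. -/
theorem apply_le_mul_supNormOn_fderiv (hΩ : Convex ℝ Ω) (hc : IsCompact Ω) {h : Distr N}
    (hh : h ∈ X0 Ω) {m : ℝ} (hm : W1 Ω h ≤ m) (φ : Test N) :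
    h φ ≤ m * supNormOn Ω (fderiv ℝ φ) := by
  obtain ⟨C, hC0, hC⟩ := X0.exists_abs_le hh
  set L := supNormOn Ω (fderiv ℝ φ)
  have hL0 : 0 ≤ L := supNormOn_nonneg _
  refine le_of_forall_pos_le_add_mul (B := m + C * 2) fun ε hε ↦ ?_
  obtain ⟨u, -, huL, hu⟩ := exists_test_approx hΩ hc φ.contDiff_one hε
  have hLε : 0 < L + ε := by positivity
  have h1 : (L + ε)⁻¹ * h u ≤ m := by
    rw [← EReal.coe_le_coe_iff]
    refine le_trans ?_ hm
    have h2 : pairing Ω h ((L + ε)⁻¹ • u : Test N) = (L + ε)⁻¹ * h u := by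
      rw [pairing_test hΩ hc hh, map_smul, smul_eq_mul]
    rw [← h2]
    refine le_iSup₂_of_le (((L + ε)⁻¹ • u : Test N) : Space N → ℝ)
      ⟨((L + ε)⁻¹ • u : Test N).isC10, fun x ↦ ?_⟩ le_rfl
    rw [Test.fderiv_smul, norm_smul, Real.norm_of_nonneg (inv_nonneg.2 hLε.le),
      inv_mul_le_iff₀ hLε, mul_one]
    exact huL x
  rw [inv_mul_le_iff₀ hLε] at h1
  have h2 : |h (φ - u)| ≤ C * (ε + ε) := by
    refine (hC _).trans ?_
    gcongr
    · refine supNormOn_le hε.le fun x hx ↦ ?_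
      rw [FunLike.coe_sub, Pi.sub_apply, norm_sub_rev]
      exact (hu x hx).1
    · refine supNormOn_le hε.le fun x hx ↦ ?_
      rw [Test.fderiv_sub, norm_sub_rev]
      exact (hu x hx).2
  rw [map_sub] at h2
  have := (abs_le.1 h2).2
  linarith

/-- The pairs of points of `Ω` at distance at least `τ`. -/
abbrev FarPairs (Ω : Set (Space N)) (τ : ℝ) : Type :=
  {p : Ω × Ω // τ ≤ ‖(p.2 : Space N) - p.1‖}

theorem compactSpace_farPairs (hc : IsCompact Ω) (τ : ℝ) : CompactSpace (FarPairs Ω τ) := by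
  have := isCompact_iff_compactSpace.1 hc
  refine isCompact_iff_compactSpace.1 (IsClosed.isCompact ?_)
  have h : Continuous fun p : Ω × Ω ↦ ‖(p.2 : Space N) - p.1‖ := by fun_prop
  exact isClosed_le continuous_const h

/-- The directional derivatives of a `C¹` function, as a continuous function. -/
noncomputable def gradMap (Ω : Set (Space N)) (u : Space N → ℝ) (hu : ContDiff ℝ 1 u) :
    C(Ω × sphere (0 : Space N) 1, ℝ) where
  toFun p := fderiv ℝ u p.1 p.2
  continuous_toFun :=
    ((hu.continuous_fderiv (by simp)).comp (continuous_subtype_val.comp continuous_fst)).clm_apply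
      (continuous_subtype_val.comp continuous_snd)

/-- The slopes of a `C¹` function between points of `Ω` at distance at least `τ`, as a continuous
function. -/
noncomputable def slopeMap (Ω : Set (Space N)) {τ : ℝ} (hτ : 0 < τ) (u : Space N → ℝ)
    (hu : ContDiff ℝ 1 u) : C(FarPairs Ω τ, ℝ) where
  toFun p := (u p.1.2 - u p.1.1) / ‖(p.1.2 : Space N) - p.1.1‖
  continuous_toFun := by
    have := hu.continuous
    exact Continuous.div (by fun_prop) (by fun_prop) fun p ↦ (hτ.trans_le p.2).ne'

/-- `gradMap` on test functions. -/
noncomputable def gradLM (Ω : Set (Space N)) :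
    Test N →ₗ[ℝ] C(Ω × sphere (0 : Space N) 1, ℝ) where
  toFun φ := gradMap Ω φ φ.contDiff_one
  map_add' φ ψ := by
    ext p
    exact congrArg (fun A : Space N →L[ℝ] ℝ ↦ A p.2) (Test.fderiv_add φ ψ p.1)
  map_smul' c φ := by
    ext p
    exact congrArg (fun A : Space N →L[ℝ] ℝ ↦ A p.2) (Test.fderiv_smul c φ p.1)

/-- `slopeMap` on test functions. -/
noncomputable def slopeLM (Ω : Set (Space N)) {τ : ℝ} (hτ : 0 < τ) :
    Test N →ₗ[ℝ] C(FarPairs Ω τ, ℝ) where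
  toFun φ := slopeMap Ω hτ φ φ.contDiff_one
  map_add' φ ψ := by
    ext p
    change (φ p.1.2 + ψ p.1.2 - (φ p.1.1 + ψ p.1.1)) / _ =
      (φ p.1.2 - φ p.1.1) / _ + (ψ p.1.2 - ψ p.1.1) / _
    rw [add_sub_add_comm, add_div]
  map_smul' c φ := by
    ext p
    change (c * φ p.1.2 - c * φ p.1.1) / _ = c * ((φ p.1.2 - φ p.1.1) / _)
    rw [← mul_sub, mul_div_assoc]

theorem le_norm_sup_zero {X : Type*} [TopologicalSpace X] [CompactSpace X] (F : C(X, ℝ)) (x : X) :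
    F x ≤ ‖F ⊔ 0‖ :=
  (le_max_left (F x) 0).trans ((le_abs_self _).trans ((F ⊔ 0).norm_coe_le_norm x))

/-- The sphere is symmetric, so one-sided bounds suffice. Thus the positive part of `gradLM` already
controls the full gradient. -/
theorem norm_le_of_sphere_le (A : Space N →L[ℝ] ℝ) {s : ℝ} (hs : 0 ≤ s)
    (h : ∀ v ∈ sphere (0 : Space N) 1, A v ≤ s) : ‖A‖ ≤ s := by
  have h1 : ∀ v, A v ≤ s * ‖v‖ := by
    intro v
    rcases eq_or_ne v 0 with rfl | hv
    · simp
    · have hv' : 0 < ‖v‖ := norm_pos_iff.2 hv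
      have h2 := h (‖v‖⁻¹ • v) (by
        rw [mem_sphere_zero_iff_norm, norm_smul, norm_inv, norm_norm, inv_mul_cancel₀ hv'.ne'])
      rw [map_smul, smul_eq_mul, inv_mul_le_iff₀ hv'] at h2
      linarith
  refine A.opNorm_le_bound hs fun v ↦ abs_le.2 ⟨?_, h1 v⟩
  have := h1 (-v)
  rw [map_neg, norm_neg] at this
  linarith

theorem exists_le_grad_slope_of_X0sharp (hΩ : Convex ℝ Ω) (hc : IsCompact Ω)
    [CompactSpace Ω] [∀ τ, CompactSpace (FarPairs Ω τ)] {g : Distr N}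
    (hg : g ∈ X0sharp Ω) {ε : ℝ} (hε : 0 < ε) :
    ∃ (τ : ℝ) (hτ : 0 < τ) (b : ℝ), 0 ≤ b ∧ ∀ φ : Test N,
      g φ ≤ 2 * ε * ‖gradLM Ω φ ⊔ 0‖ + b * ‖slopeLM Ω hτ φ ⊔ 0‖ := by
  obtain ⟨C, hC0, hC⟩ := hg.2 ε hε
  have hτ : 0 < ε / C := div_pos hε hC0
  have hD : ∀ x ∈ Ω, ∀ y ∈ Ω, ‖y - x‖ ≤ diam Ω := fun x hx y hy ↦ by
    rw [← dist_eq_norm]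
    exact dist_le_diam_of_mem hc.isBounded hy hx
  -- With `τ = ε / C`, near pairs cost `C * τ * s = ε * s`; the gradient term of `hC` gives the
  -- second `ε * s`.
  refine ⟨ε / C, hτ, C * diam Ω, mul_nonneg hC0.le diam_nonneg, fun φ ↦ ?_⟩
  set s := ‖gradLM Ω φ ⊔ 0‖
  set r := ‖slopeLM Ω hτ φ ⊔ 0‖
  have hs : 0 ≤ s := norm_nonneg _
  have hr : 0 ≤ r := norm_nonneg _
  have hgrad : ∀ x ∈ Ω, ‖fderiv ℝ φ x‖ ≤ s := fun x hx ↦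
    norm_le_of_sphere_le _ hs fun v hv ↦ le_norm_sup_zero (gradLM Ω φ) (⟨x, hx⟩, ⟨v, hv⟩)
  have hosc : ∀ x ∈ Ω, ∀ y ∈ Ω, φ y - φ x ≤ diam Ω * r + ε / C * s := by
    intro x hx y hy
    have h0 : 0 ≤ diam Ω := diam_nonneg
    by_cases hxy : ε / C ≤ ‖y - x‖
    · have h1 : (φ y - φ x) / ‖y - x‖ ≤ r :=
        le_norm_sup_zero (slopeLM Ω hτ φ) ⟨(⟨x, hx⟩, ⟨y, hy⟩), hxy⟩
      rw [div_le_iff₀ (hτ.trans_le hxy)] at h1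
      have h2 := mul_le_mul_of_nonneg_left (hD x hx y hy) hr
      have h3 := mul_nonneg hτ.le hs
      linarith
    · have h1 := hΩ.norm_image_sub_le_of_norm_fderiv_le (𝕜 := ℝ) (fun x _ ↦ φ.differentiable x)
        hgrad hx hy
      have h2 := mul_le_mul_of_nonneg_left (not_le.1 hxy).le hs
      have h3 := mul_nonneg h0 hr
      rw [Real.norm_eq_abs] at h1
      linarith [le_abs_self (φ y - φ x)]
  rcases Ω.eq_empty_or_nonempty with hemp | ⟨x₀, hx₀⟩
  · rw [hg.1.2 φ ⟨0, fun x hx ↦ by simp [hemp] at hx⟩]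
    have := diam_nonneg (s := Ω)
    positivity
  obtain ⟨χ, hχ⟩ := exists_test_eq_one hc
  -- Normalising at `x₀` turns the sup norm into an oscillation without changing `g φ`.
  have h1 : g φ = g (φ - φ x₀ • χ) := by
    rw [map_sub, map_smul, hg.1.2 χ ⟨1, fun x hx ↦ (hχ x hx).1⟩, smul_zero, sub_zero]
  have hB0 : 0 ≤ diam Ω * r + ε / C * s := by
    have := diam_nonneg (s := Ω)
    positivity
  have h2 : supNormOn Ω (φ - φ x₀ • χ : Test N) ≤ diam Ω * r + ε / C * s := by
    refine supNormOn_le hB0 fun x hx ↦ ?_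
    rw [FunLike.coe_sub, FunLike.coe_smul, Pi.sub_apply, Pi.smul_apply, (hχ x hx).1, smul_eq_mul,
      mul_one, Real.norm_eq_abs]
    exact abs_le.2 ⟨by linarith [hosc x hx x₀ hx₀], hosc x₀ hx₀ x hx⟩
  have h3 : supNormOn Ω (fderiv ℝ (φ - φ x₀ • χ : Test N)) ≤ s := by
    refine supNormOn_le hs fun x hx ↦ ?_
    rw [Test.fderiv_sub, Test.fderiv_smul, (hχ x hx).2, smul_zero, sub_zero]
    exact hgrad x hx
  calc g φ ≤ C * (diam Ω * r + ε / C * s) + ε * s := by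
        rw [h1]
        refine (le_abs_self _).trans ((hC _).trans ?_)
        gcongr
    _ = _ := by
        field_simp
        ring

/-- The inclusion of `Ω × S^{N-1}` in the phase space as the set of steps of length `0`. -/
def zeroStep (p : Ω × sphere (0 : Space N) 1) : Phase Ω :=
  (p.1, p.2, ⟨0, self_mem_Ici⟩)

/-- The step from `x` to `y`, for `(x, y)` a pair of distant points. -/
noncomputable def farStep {τ : ℝ} (hτ : 0 < τ) (p : FarPairs Ω τ) : Phase Ω :=
  (p.1.1, ⟨‖(p.1.2 : Space N) - p.1.1‖⁻¹ • ((p.1.2 : Space N) - p.1.1), by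
    rw [mem_sphere_zero_iff_norm, norm_smul, norm_inv, norm_norm,
      inv_mul_cancel₀ (hτ.trans_le p.2).ne']⟩, ⟨‖(p.1.2 : Space N) - p.1.1‖, norm_nonneg _⟩)

theorem measurable_zeroStep : Measurable (zeroStep (Ω := Ω)) := by
  refine Continuous.measurable ?_
  unfold zeroStep
  fun_prop

theorem measurable_farStep {τ : ℝ} (hτ : 0 < τ) : Measurable (farStep (Ω := Ω) hτ) := by
  refine Continuous.measurable ?_
  have h : Continuous fun p : FarPairs Ω τ ↦ ‖(p.1.2 : Space N) - p.1.1‖ := by fun_prop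
  refine Continuous.prodMk (by fun_prop) (Continuous.prodMk (Continuous.subtype_mk ?_ _)
    (Continuous.subtype_mk h _))
  exact (h.inv₀ fun p ↦ (hτ.trans_le p.2).ne').smul (by fun_prop)

theorem diffQuot_zeroStep (u : Space N → ℝ) (hu : ContDiff ℝ 1 u)
    (p : Ω × sphere (0 : Space N) 1) :
    diffQuot u ((zeroStep p).1 : Space N) ((zeroStep p).2.1 : Space N) ((zeroStep p).2.2 : ℝ) =
      gradMap Ω u hu p :=
  if_pos rfl

theorem diffQuot_farStep (u : Space N → ℝ) (hu : ContDiff ℝ 1 u) {τ : ℝ} (hτ : 0 < τ)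
    (p : FarPairs Ω τ) :
    diffQuot u ((farStep hτ p).1 : Space N) ((farStep hτ p).2.1 : Space N)
      ((farStep hτ p).2.2 : ℝ) = slopeMap Ω hτ u hu p := by
  have h := (hτ.trans_le p.2).ne'
  simp only [diffQuot, farStep, slopeMap, if_neg h, ContinuousMap.coe_mk, smul_smul,
    mul_inv_cancel₀ h, one_smul, add_sub_cancel]

/-- A finite measure built from infinitesimal steps and from steps between distant points of `Ω`
represents the continuous extension of `φ ↦ ∫ ∇φ(x) · v dμ + ∫ (φ(y) - φ(x)) / |y - x| dν`. -/
theorem map_add_map_mem_admissible (hΩ : Convex ℝ Ω) (hc : IsCompact Ω)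
    [CompactSpace Ω] [∀ τ, CompactSpace (FarPairs Ω τ)] {f : Distr N} (hf : f ∈ X0 Ω)
    {τ : ℝ} (hτ : 0 < τ) (μ : Measure (Ω × sphere (0 : Space N) 1)) (ν : Measure (FarPairs Ω τ))
    [IsFiniteMeasure μ] [IsFiniteMeasure ν]
    (h : ∀ φ : Test N, f φ = ∫ p, gradLM Ω φ p ∂μ + ∫ p, slopeLM Ω hτ φ p ∂ν) :
    μ.map zeroStep + ν.map (farStep hτ) ∈ admissible Ω f := by
  refine ⟨inferInstance, fun u hu ↦ ?_⟩
  have hu := hu.1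
  have hm := measurable_diffQuot (Ω := Ω) hu
  have hiμ (F : C(Ω × sphere (0 : Space N) 1, ℝ)) : Integrable F μ :=
    .of_bound F.continuous.aestronglyMeasurable _ (.of_forall F.norm_coe_le_norm)
  have hiν (F : C(FarPairs Ω τ, ℝ)) : Integrable F ν :=
    .of_bound F.continuous.aestronglyMeasurable _ (.of_forall F.norm_coe_le_norm)
  have h1 : ∫ p, diffQuot u (p.1 : Space N) (p.2.1 : Space N) (p.2.2 : ℝ)
      ∂(μ.map zeroStep + ν.map (farStep hτ)) =
      ∫ p, gradMap Ω u hu p ∂μ + ∫ p, slopeMap Ω hτ u hu p ∂ν := by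
    rw [integral_add_measure, integral_map measurable_zeroStep.aemeasurable
      hm.aestronglyMeasurable, integral_map (measurable_farStep hτ).aemeasurable
      hm.aestronglyMeasurable]
    · simp_rw [diffQuot_zeroStep u hu, diffQuot_farStep u hu]
    · refine (integrable_map_measure hm.aestronglyMeasurable
        measurable_zeroStep.aemeasurable).2 ((hiμ (gradMap Ω u hu)).congr (.of_forall fun p ↦ ?_))
      exact (diffQuot_zeroStep u hu p).symm
    · refine (integrable_map_measure hm.aestronglyMeasurable
        (measurable_farStep hτ).aemeasurable).2
        ((hiν (slopeMap Ω hτ u hu)).congr (.of_forall fun p ↦ ?_))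
      exact (diffQuot_farStep u hu hτ p).symm
  rw [h1]
  -- The formula holds on test functions; both sides are continuous in C¹(Ω), so it passes to `u` by
  -- uniqueness of limits. Slopes are stable because denominators are at least `τ`.
  have hne := c1Approach_neBot hΩ hc hu
  refine (tendsto_nhds_unique (tendsto_pairing hΩ hc hf hu) ?_).symm
  refine Metric.tendsto_nhds.2 fun ε hε ↦ ?_
  set B := μ.real univ + 2 / τ * ν.real univ
  have hB : 0 ≤ B := by positivity
  have hη : 0 < ε / (B + 1) := by positivity
  filter_upwards [(hasBasis_c1Approach Ω u).mem_of_mem hη] with φ hφ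
  set η := ε / (B + 1)
  have h2 : ‖∫ p, gradLM Ω φ p ∂μ - ∫ p, gradMap Ω u hu p ∂μ‖ ≤ η * μ.real univ := by
    rw [← integral_sub (hiμ _) (hiμ _)]
    refine norm_integral_le_of_norm_le_const (.of_forall fun p ↦ ?_)
    have h3 := (fderiv ℝ φ p.1 - fderiv ℝ u p.1).le_opNorm (p.2 : Space N)
    rw [norm_eq_of_mem_sphere, mul_one] at h3
    exact h3.trans (hφ p.1 p.1.2).2
  have h3 : ‖∫ p, slopeLM Ω hτ φ p ∂ν - ∫ p, slopeMap Ω hτ u hu p ∂ν‖ ≤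
      2 * η / τ * ν.real univ := by
    rw [← integral_sub (hiν _) (hiν _)]
    refine norm_integral_le_of_norm_le_const (.of_forall fun p ↦ ?_)
    change |(φ p.1.2 - φ p.1.1) / ‖(p.1.2 : Space N) - p.1.1‖ -
      (u p.1.2 - u p.1.1) / ‖(p.1.2 : Space N) - p.1.1‖| ≤ _
    rw [← sub_div, abs_div, abs_norm]
    have h4 := abs_le.1 (hφ p.1.2 p.1.2.2).1
    have h5 := abs_le.1 (hφ p.1.1 p.1.1.2).1
    exact div_le_div₀ (by positivity) (abs_le.2 ⟨by linarith, by linarith⟩) hτ p.2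
  rw [h, dist_eq_norm, add_sub_add_comm]
  calc _ ≤ η * μ.real univ + 2 * η / τ * ν.real univ := norm_add_le_of_le h2 h3
    _ = B / (B + 1) * ε := by simp only [η, B]; ring
    _ < 1 * ε := by
      gcongr
      rw [div_lt_one (by positivity)]
      linarith
    _ = ε := one_mul ε

theorem slice0_map_add_map (μ : Measure (Ω × sphere (0 : Space N) 1)) {τ : ℝ} (hτ : 0 < τ)
    (ν : Measure (FarPairs Ω τ)) :
    slice0 (μ.map zeroStep + ν.map (farStep hτ)) univ = μ univ := by
  rw [slice0, Measure.restrict_apply_univ, Measure.add_apply,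
    Measure.map_apply measurable_zeroStep measurableSet_slice,
    Measure.map_apply (measurable_farStep hτ) measurableSet_slice]
  have h1 : zeroStep ⁻¹' {p : Phase Ω | (p.2.2 : ℝ) = 0} = univ := eq_univ_of_forall fun _ ↦ rfl
  have h2 : farStep hτ ⁻¹' {p : Phase Ω | (p.2.2 : ℝ) = 0} = ∅ :=
    eq_empty_of_forall_notMem fun p hp ↦ (hτ.trans_le p.2).ne' hp
  rw [h1, h2, measure_empty, add_zero]

/-- For any real `z > W¹(f - g)`, a measure with slice mass at most `z` is built. -/
theorem iInf_slice0_le_distX0sharp (hΩ : Convex ℝ Ω) (hc : IsCompact Ω) {f : Distr N}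
    (hf : f ∈ X0 Ω) :
    ⨅ σ ∈ admissible Ω f, ((slice0 σ univ : ENNReal) : EReal) ≤ distX0sharp Ω f := by
  have := isCompact_iff_compactSpace.1 hc
  have := compactSpace_farPairs hc
  refine le_iInf₂ fun g hg ↦ EReal.le_of_forall_lt_iff_le.1 fun z hz ↦ ?_
  obtain ⟨m, hm, hmz⟩ := EReal.lt_iff_exists_real_btwn.1 hz
  rw [EReal.coe_lt_coe_iff] at hmz
  have hfg := X0.sub hf hg.1
  have hm0 : 0 ≤ m := by
    rw [← EReal.coe_le_coe_iff]
    exact (W1_nonneg hΩ hc hfg).trans hm.le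
  -- Taking `ε = (z - m) / 2` makes the gradient coefficient of `g` equal to `z - m`, so that of `f`
  -- is `z`.
  obtain ⟨τ, hτ, b, hb, hgb⟩ := exists_le_grad_slope_of_X0sharp hΩ hc hg
    (half_pos (sub_pos.2 hmz))
  obtain ⟨μ, ν, hμ, hν, hμz, hμν⟩ := exists_measures_of_le (gradLM Ω) (slopeLM Ω hτ)
    (f : Test N →ₗ[ℝ] ℝ) (hm0.trans hmz.le) hb fun φ ↦ by
      have h1 := apply_le_mul_supNormOn_fderiv hΩ hc hfg hm.le φ
      have h2 : supNormOn Ω (fderiv ℝ φ) ≤ ‖gradLM Ω φ ⊔ 0‖ :=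
        supNormOn_le (norm_nonneg _) fun x hx ↦ norm_le_of_sphere_le _ (norm_nonneg _)
          fun v hv ↦ le_norm_sup_zero (gradLM Ω φ) (⟨x, hx⟩, ⟨v, hv⟩)
      have h3 := mul_le_mul_of_nonneg_left h2 hm0
      have h4 := hgb φ
      change f φ - g φ ≤ _ at h1
      change f φ ≤ _
      linarith
  refine (iInf₂_le _ (map_add_map_mem_admissible hΩ hc hf hτ μ ν hμν)).trans ?_
  rw [slice0_map_add_map, ← EReal.coe_ennreal_toReal (measure_ne_top _ _), EReal.coe_le_coe_iff]
  exact ENNReal.toReal_le_of_le_ofReal (hm0.trans hmz.le) hμz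

end LowerBound

end Transhipment

theorem mainTheorem4 (N : ℕ) (Ω : Set (Transhipment.Space N)) (hΩ_convex : Convex ℝ Ω)
    (hΩ_compact : IsCompact Ω) (f : Transhipment.Distr N) (hf : f ∈ Transhipment.X0 Ω) :
    Transhipment.distX0sharp Ω f =
      ⨅ σ ∈ Transhipment.admissible Ω f,
        ((Transhipment.slice0 σ Set.univ : ENNReal) : EReal) :=
  le_antisymm (le_iInf₂ fun _ hσ ↦ Transhipment.distX0sharp_le hΩ_convex hΩ_compact hf hσ)
    (Transhipment.iInf_slice0_le_distX0sharp hΩ_convex hΩ_compact hf)
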